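/- Let $\mathbb H$ be the hyperbolic plane and let $D\subset\mathbb H$ be a domain (a non-empty connected open set) whose boundary $\partial D$ in $\mathbb H$ is an ideal geodesic polygon, i.e. a simple closed polygon with finitely many (at least three) distinct vertices, all lying on the ideal boundary $\partial_\infty\mathbb H$, whose sides are the complete geodesics joining consecutive vertices. Let $U\subset D$ be a domain (not necessarily bounded), and denote by $\overline U$ and $\partial U$ its closure and boundary in $\mathbb H$. Let $u,v\in C^0(\overline U)$ be two functions that are $C^2$ solutions in $U$ of the minimal surface equation $$\operatorname{div}\left(\frac{\nabla u}{\sqrt{1+|\nabla u|^2}}\right)=0$$ (gradient, norm and divergence being those of the hyperbolic metric). If $u\le v$ on $\partial U$, then $u\le v$ in $U$. -/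

import Mathlib

open UpperHalfPlane

noncomputable section

/-- The complete geodesic of the hyperbolic plane (upper half-plane model) with endpoints `a` and `b`
on the ideal boundary `ℝ ∪ {∞}`: a vertical half-line if one endpoint is `∞`, and otherwise the
half-circle with diameter `[a, b]`. It is empty if `a = b`. -/
def idealGeodesic : OnePoint ℝ → OnePoint ℝ → Set ℍ
  | OnePoint.infty, OnePoint.infty => ∅
  | OnePoint.some a, OnePoint.infty => {z | z.re = a}
  | OnePoint.infty, OnePoint.some b => {z | z.re = b}
  | OnePoint.some a, OnePoint.some b => {z | (z.re - a) * (z.re - b) + z.im ^ 2 = 0}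

/-- `Γ` is an ideal geodesic polygon: a simple closed polygon with finitely many (at least three)
distinct vertices, all of them on the ideal boundary, whose sides are the complete geodesics
joining cyclically consecutive vertices. -/
def IsIdealPolygon (Γ : Set ℍ) : Prop :=
  ∃ n : ℕ, 3 ≤ n ∧ ∃ a : ZMod n → OnePoint ℝ,
    Function.Injective a ∧
    (∀ i j : ZMod n, i ≠ j →
      Disjoint (idealGeodesic (a i) (a (i + 1))) (idealGeodesic (a j) (a (j + 1)))) ∧
    Γ = ⋃ i : ZMod n, idealGeodesic (a i) (a (i + 1))

/-- Partial derivative in the coordinate `x = re z`. -/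
def partialX (f : ℂ → ℝ) (z : ℂ) : ℝ := fderiv ℝ f z 1

/-- Partial derivative in the coordinate `y = im z`. -/
def partialY (f : ℂ → ℝ) (z : ℂ) : ℝ := fderiv ℝ f z Complex.I

/-- A function on the hyperbolic plane, read in the global half-plane coordinate `z = x + i y`. -/
def inCoord (u : ℍ → ℝ) : ℂ → ℝ := fun z => u (ofComplex z)

/-- The gradient for the metric `(dx² + dy²) / y²`; the vector `p ∂_x + q ∂_y` is
written as the complex number `p + i q`. -/
def hypGrad (f : ℂ → ℝ) (z : ℂ) : ℂ :=
  ⟨z.im ^ 2 * partialX f z, z.im ^ 2 * partialY f z⟩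

/-- The length of the tangent vector `V` at `z` for the metric `(dx² + dy²) / y²`. -/
def hypNorm (z V : ℂ) : ℝ := ‖V‖ / z.im

/-- The divergence of a vector field for the metric `(dx² + dy²) / y²`, whose
area density is `1 / y²`. -/
def hypDiv (X : ℂ → ℂ) (z : ℂ) : ℝ :=
  z.im ^ 2 * (partialX (fun w => (X w).re / w.im ^ 2) z + partialY (fun w => (X w).im / w.im ^ 2) z)

/-- The vector field `∇u / W` with `W = √(1 + |∇u|²)`. -/
def fluxField (f : ℂ → ℝ) (z : ℂ) : ℂ :=
  hypGrad f z / (Real.sqrt (1 + hypNorm z (hypGrad f z) ^ 2) : ℂ)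

/-- `u` is a (classical) solution of the minimal surface equation `div (∇u / W) = 0` on the
open set `U` of the hyperbolic plane, i.e. the graph of `u` over `U` is minimal in `ℍ × ℝ`. -/
def IsMinimalSolution (U : Set ℍ) (u : ℍ → ℝ) : Prop :=
  ContDiffOn ℝ 2 (inCoord u) ((fun z : ℍ => (z : ℂ)) '' U) ∧
    ∀ z ∈ U, hypDiv (fluxField (inCoord u)) (z : ℂ) = 0

end

/-! Suppose `w = u - v` is positive somewhere. The difference of the fluxes `∇u / W_u - ∇v / W_v` is
divergence free; test it against a cutoff of hyperbolic size `m` times a bounded step function of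
`w` that vanishes for `w ≤ ε`. Since `w ≤ 0` on the boundary, the product has compact support inside
`U`, so no regularity of `∂U` and no boundedness of `U` is needed. Integration by parts balances two
terms. The one with `∇w` is nonnegative, because `p ↦ p / √(1 + |p|²)` is monotone
(`flux_monotone`), and its integrand vanishes only where the gradients agree (`eq_of_flux_eq_zero`).
The one with the gradient of the cutoff is at most a constant times `area(U) / m`, because the
fluxes are bounded whatever the gradients are. The area is finite
(`integrableOn_of_isIdealPolygon_frontier`), so `m → ∞` gives `∇u = ∇v` wherever `w > 0`
(`partial_eq_of_pos`). Hence `w` is a positive constant on the connected set `U`, and on `∂U` by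
continuity. This contradicts `w ≤ 0` there; `∂U` is non-empty because `U ⊆ D ≠ ℍ`. For the area, `D`
is covered by finitely many regions, each above one half-circle and between the verticals at its
endpoints. A side over a given abscissa is found by a discrete crossing argument along the vertices.
-/

/-! ### Covering an ideal polygon by strips above half-circles -/

/-- The part of the vertical strip over the interval between `p` and `q` that lies above the
half-circle with diameter `[p, q]`. -/
def stripAbove (p q : ℝ) : Set ℂ :=
  {z | z.re ∈ Set.uIoc p q ∧ 0 < z.im ∧ 0 < (z.re - p) * (z.re - q) + z.im ^ 2}

theorem pos_or_neg_of_ne_zero {X : Type*} [TopologicalSpace X] {D : Set X} (hD : IsPreconnected D)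
    {F : X → ℝ} (hF : Continuous F) (h0 : ∀ z ∈ D, F z ≠ 0) :
    (∀ z ∈ D, 0 < F z) ∨ (∀ z ∈ D, F z < 0) := by
  by_contra! h
  obtain ⟨⟨x, hx, hx'⟩, ⟨y, hy, hy'⟩⟩ := h
  obtain ⟨z, hz, hz'⟩ := hD.intermediate_value hx hy hF.continuousOn ⟨hx', hy'⟩
  exact h0 z hz hz'

/-- A discrete intermediate value theorem: `x ∉ uIoc (c j) (c (j + 1))` says that `c j < x` and `c
(j + 1) < x` have the same truth value, which then propagates from `0` to `N`. -/
theorem exists_mem_uIoc_of_crossing (c : ℕ → ℝ) (N : ℕ) (x : ℝ) (h : x ∈ Set.uIoc (c 0) (c N)) :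
    ∃ j < N, x ∈ Set.uIoc (c j) (c (j + 1)) := by
  by_contra! hc
  have key : ∀ j ≤ N, (c j < x ↔ c 0 < x) := by
    intro j
    induction j with
    | zero => simp
    | succ j ih =>
      intro hj
      have h1 := hc j (by omega)
      have h2 := ih (by omega)
      rw [Set.mem_uIoc] at h1
      push Not at h1
      rw [← h2]
      constructor
      · intro h3
        by_contra! h4
        exact absurd (h1.2 h3) (not_lt.2 h4)
      · intro h3
        exact h1.1 h3
  have h1 := key N le_rfl
  rw [Set.mem_uIoc] at h
  rcases h with h | h
  · exact absurd (h1.2 h.1) (not_lt.2 h.2)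
  · exact absurd (h1.1 h.1) (not_lt.2 h.2)

theorem zmod_add_natCast_ne {n : ℕ} (k : ZMod n) {j : ℕ} (h0 : 0 < j) (hj : j < n) :
    k + j ≠ k := by
  intro h
  have : (j : ZMod n) = 0 := by simpa using h
  rw [ZMod.natCast_eq_zero_iff] at this
  exact absurd (Nat.le_of_dvd h0 this) (by omega)

theorem mem_idealGeodesic_coe {p q : ℝ} {z : ℍ} :
    z ∈ idealGeodesic (p : OnePoint ℝ) (q : OnePoint ℝ) ↔
      (z.re - p) * (z.re - q) + z.im ^ 2 = 0 := Iff.rfl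

/-- A point of a half-circle geodesic over a prescribed abscissa. -/
theorem exists_mem_idealGeodesic_re {p q x : ℝ} (h : (x - p) * (x - q) < 0) :
    ∃ z : ℍ, z.re = x ∧ z ∈ idealGeodesic (p : OnePoint ℝ) (q : OnePoint ℝ) ∧
      z.im ^ 2 = - ((x - p) * (x - q)) := by
  refine ⟨⟨⟨x, Real.sqrt (-((x - p) * (x - q)))⟩, Real.sqrt_pos.2 (by linarith)⟩, rfl, ?_, ?_⟩
  · rw [mem_idealGeodesic_coe]
    change (x - p) * (x - q) + (Real.sqrt (-((x - p) * (x - q)))) ^ 2 = 0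
    rw [Real.sq_sqrt (by linarith)]; ring
  · change (Real.sqrt (-((x - p) * (x - q)))) ^ 2 = _
    rw [Real.sq_sqrt (by linarith)]

/-- If an affine-in-`im²` function is nonnegative along a half-circle, its limit at the
endpoints is nonnegative. -/
theorem endpoint_nonneg {p q a b : ℝ} (hpq : p ≠ q) {s : ℝ}
    (h : ∀ z ∈ idealGeodesic (p : OnePoint ℝ) (q : OnePoint ℝ),
      0 ≤ s * ((z.re - a) * (z.re - b) + z.im ^ 2)) :
    0 ≤ s * ((p - a) * (p - b)) ∧ 0 ≤ s * ((q - a) * (q - b)) := by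
  -- On the half-circle `im² = -(x - p) * (x - q)`, so the expression is a polynomial in the
  -- abscissa alone and its sign passes to the endpoints.
  set G : ℝ → ℝ := fun x => s * ((x - a) * (x - b) - (x - p) * (x - q)) with hG
  have hcl : IsClosed {x | 0 ≤ G x} := isClosed_le continuous_const (by fun_prop)
  have hsub : Set.Ioo (min p q) (max p q) ⊆ {x | 0 ≤ G x} := by
    intro x hx
    have hneg : (x - p) * (x - q) < 0 := by
      rcases le_total p q with h | h
      · simp only [min_eq_left h, max_eq_right h, Set.mem_Ioo] at hx
        nlinarith
      · simp only [min_eq_right h, max_eq_left h, Set.mem_Ioo] at hx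
        nlinarith
    obtain ⟨z, hz, hzm, him⟩ := exists_mem_idealGeodesic_re hneg
    have := h z hzm
    rw [hz, him] at this
    simpa [hG, sub_eq_add_neg] using this
  have := hcl.closure_subset_iff.2 hsub
  rw [closure_Ioo (by simpa using hpq)] at this
  have h1 := this (show p ∈ _ from ⟨min_le_left _ _, le_max_left _ _⟩)
  have h2 := this (show q ∈ _ from ⟨min_le_right _ _, le_max_right _ _⟩)
  simp only [hG, Set.mem_ofPred_eq, sub_self, zero_mul, mul_zero, sub_zero] at h1 h2
  exact ⟨h1, h2⟩

theorem exists_stripAbove_cover {D : Set ℍ} (hDo : IsOpen D) (hDc : IsConnected D)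
    (hD : IsIdealPolygon (frontier D)) :
    ∃ s : Finset (ℝ × ℝ), ∀ z ∈ D, ∃ p ∈ s, (z : ℂ) ∈ stripAbove p.1 p.2 := by
  obtain ⟨n, hn, a, ha, -, hΓ⟩ := hD
  have : NeZero n := ⟨by omega⟩
  have h1n : (1 : ZMod n) ≠ 0 := by
    have := zmod_add_natCast_ne (0 : ZMod n) (j := 1) (by omega) (by omega)
    simpa using this
  have h2n : (1 + 1 : ZMod n) ≠ 0 := by
    have := zmod_add_natCast_ne (0 : ZMod n) (j := 2) (by omega) (by omega)
    rw [one_add_one_eq_two]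
    simpa using this
  have hdisj : ∀ z ∈ D, ∀ i, z ∉ idealGeodesic (a i) (a (i + 1)) := by
    intro z hz i hi
    have : z ∈ frontier D := by rw [hΓ]; exact Set.mem_iUnion.2 ⟨i, hi⟩
    rw [hDo.frontier_eq] at this
    exact this.2 hz
  have hcl : ∀ i, ∀ z ∈ idealGeodesic (a i) (a (i + 1)), z ∈ closure D := by
    intro i z hi
    have : z ∈ frontier D := by rw [hΓ]; exact Set.mem_iUnion.2 ⟨i, hi⟩
    exact frontier_subset_closure this
  have hcont : ∀ p q : ℝ, Continuous fun z : ℍ => (z.re - p) * (z.re - q) + z.im ^ 2 := by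
    intro p q
    fun_prop
  -- A vertex at infinity gets the default value `0`. The strips it produces are harmless extra
  -- members of the family; the side chosen below never has an infinite endpoint.
  set b : ZMod n → ℝ := fun i => (a i).elim 0 id with hb
  have hb' : ∀ i, a i ≠ OnePoint.infty → a i = (b i : OnePoint ℝ) := by
    intro i hi
    obtain ⟨x, hx⟩ := OnePoint.ne_infty_iff_exists.1 hi
    simp only [hb]
    rw [← hx]
    rfl
  refine ⟨Finset.univ.image fun i : ZMod n => (b i, b (i + 1)), fun z hz => ?_⟩
  suffices h : ∃ i, (z : ℂ) ∈ stripAbove (b i) (b (i + 1)) by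
    obtain ⟨i, hi⟩ := h
    exact ⟨_, Finset.mem_image_of_mem _ (Finset.mem_univ i), hi⟩
  by_cases hinf : ∃ k, a k = OnePoint.infty
  · obtain ⟨k, hk⟩ := hinf
    have hfin : ∀ i, i ≠ k → a i = (b i : OnePoint ℝ) := fun i hi =>
      hb' i fun h => hi (ha (h.trans hk.symm))
    have hs1 : idealGeodesic (a k) (a (k + 1)) = {z | z.re = b (k + 1)} := by
      rw [hk, hfin (k + 1) (by simpa using h1n)]
      rfl
    have hs2 : idealGeodesic (a (k - 1)) (a (k - 1 + 1)) = {z | z.re = b (k - 1)} := by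
      rw [sub_add_cancel, hk, hfin (k - 1) (by simpa using h1n)]
      rfl
    have hne : b (k + 1) ≠ b (k - 1) := by
      intro h
      have : a (k + 1) = a (k - 1) := by
        rw [hfin (k + 1) (by simpa using h1n), hfin (k - 1) (by simpa using h1n), h]
      have := ha this
      apply h2n
      linear_combination this
    have hline : ∀ x : ℝ, (x = b (k + 1) ∨ x = b (k - 1)) → ∀ y : ℝ, 0 < y →
        ∃ z : ℍ, z.re = x ∧ z.im = y ∧ z ∈ closure D := by
      intro x hx y hy
      refine ⟨⟨⟨x, y⟩, hy⟩, rfl, rfl, ?_⟩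
      rcases hx with hx | hx
      · exact hcl k _ (by rw [hs1]; exact hx)
      · exact hcl (k - 1) _ (by rw [hs2]; exact hx)
    -- `D` misses the vertical line at `x`, so by connectedness it lies on one side of it, namely
    -- the side of the closure point at `x'`. Applied to both vertical sides, this puts `z.re`
    -- strictly between them.
    have side : ∀ x x' : ℝ, (∀ w ∈ D, w.re ≠ x) → (∃ w : ℍ, w.re = x' ∧ w ∈ closure D) →
        x ≠ x' → 0 < (z.re - x) * (x' - x) := by
      rintro x x' h1 ⟨w, hw, hwc⟩ hxx
      have hc : Continuous fun z : ℍ => z.re - x := by fun_prop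
      rcases pos_or_neg_of_ne_zero hDc.isPreconnected hc
        (fun w hw => sub_ne_zero.2 (h1 w hw)) with h | h
      · have h3 : 0 ≤ w.re - x :=
          closure_minimal (fun v hv => (h v hv).le) (isClosed_le continuous_const hc) hwc
        have h4 : 0 < x' - x := lt_of_le_of_ne (hw ▸ h3) (sub_ne_zero.2 hxx.symm).symm
        exact mul_pos (h z hz) h4
      · have h3 : w.re - x ≤ 0 :=
          closure_minimal (fun v hv => (h v hv).le) (isClosed_le hc continuous_const) hwc
        have h4 : x' - x < 0 := lt_of_le_of_ne (hw ▸ h3) (sub_ne_zero.2 hxx.symm)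
        exact mul_pos_of_neg_of_neg (h z hz) h4
    have e1 : 0 < (z.re - b (k + 1)) * (b (k - 1) - b (k + 1)) := by
      refine side _ _ (fun w hw h => hdisj w hw k (by rw [hs1]; exact h)) ?_ hne
      obtain ⟨w, h1, -, h2⟩ := hline _ (Or.inr rfl) 1 one_pos
      exact ⟨w, h1, h2⟩
    have e2 : 0 < (z.re - b (k - 1)) * (b (k + 1) - b (k - 1)) := by
      refine side _ _ (fun w hw h => hdisj w hw (k - 1) (by rw [hs2]; exact h)) ?_ hne.symm
      obtain ⟨w, h1, -, h2⟩ := hline _ (Or.inl rfl) 1 one_pos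
      exact ⟨w, h1, h2⟩
    -- The `n - 2` sides from vertex `k + 1` round to `k - 1` are exactly those avoiding the
    -- infinite vertex `k`.
    have hN : k + 1 + ((n - 2 : ℕ) : ZMod n) = k - 1 := by
      rw [Nat.cast_sub (by omega)]
      simp
      ring
    obtain ⟨j, hj, hjm⟩ := exists_mem_uIoc_of_crossing (fun j : ℕ => b (k + 1 + j)) (n - 2) z.re (by
      simp only [Nat.cast_zero, add_zero, hN]
      rw [Set.mem_uIoc]
      rcases lt_or_gt_of_ne hne with h | h
      · left
        constructor <;> nlinarith
      · right
        constructor <;> nlinarith)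
    have hi1 : k + 1 + (j : ZMod n) ≠ k := by
      have := zmod_add_natCast_ne k (j := j + 1) (by omega) (by omega)
      intro h; apply this; push_cast; linear_combination h
    have hi2 : k + 1 + (j : ZMod n) + 1 ≠ k := by
      have := zmod_add_natCast_ne k (j := j + 2) (by omega) (by omega)
      intro h; apply this; push_cast; linear_combination h
    refine ⟨k + 1 + j, ?_, z.im_pos, ?_⟩
    · simpa [add_assoc] using hjm
    · generalize hi : k + 1 + (j : ZMod n) = i at hi1 hi2
      have hne0 : ∀ w ∈ D, (w.re - b i) * (w.re - b (i + 1)) + w.im ^ 2 ≠ 0 := by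
        intro w hw h
        apply hdisj w hw i
        rw [hfin i hi1, hfin (i + 1) hi2]
        exact h
      rcases pos_or_neg_of_ne_zero hDc.isPreconnected (hcont _ _) hne0 with h | h
      · exact h z hz
      · exfalso
        set t := (b (k + 1) - b i) * (b (k + 1) - b (i + 1))
        -- The closure of `D` contains a whole vertical side, hence points too high to be inside the
        -- half-circle: `t + (1 + |t|)² > 0`.
        obtain ⟨w, h1, h2, h3⟩ := hline _ (Or.inl rfl) (1 + |t|) (by positivity)
        have h4 : (w.re - b i) * (w.re - b (i + 1)) + w.im ^ 2 ≤ 0 :=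
          closure_minimal (fun v hv => (h v hv).le) (isClosed_le (hcont _ _) continuous_const) h3
        rw [h1, h2] at h4
        have := neg_abs_le t
        nlinarith [abs_nonneg t]
  · push Not at hinf
    have hfin : ∀ i, a i = (b i : OnePoint ℝ) := fun i => hb' i (hinf i)
    have hbinj : Function.Injective b := by
      intro i j h
      apply ha
      rw [hfin i, hfin j, h]
    have hne1 : ∀ i, b i ≠ b (i + 1) := fun i h => h1n (by simpa using hbinj h)
    have hmem : ∀ i z, z ∈ idealGeodesic (a i) (a (i + 1)) ↔
        (z.re - b i) * (z.re - b (i + 1)) + z.im ^ 2 = 0 := by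
      intro i z
      rw [hfin i, hfin (i + 1)]
      rfl
    have hgeo : ∀ i, idealGeodesic (b i : OnePoint ℝ) (b (i + 1) : OnePoint ℝ) ⊆ closure D := by
      intro i
      rw [← hfin i, ← hfin (i + 1)]
      exact hcl i
    -- `D` is entirely outside or entirely inside each half-circle. Every side lies in the closure
    -- of `D`, so its endpoints, and thus all vertices, satisfy the same weak inequality.
    have hside : ∀ i, (∀ w ∈ D, 0 < (w.re - b i) * (w.re - b (i + 1)) + w.im ^ 2) ∧
          (∀ m, 0 ≤ (b m - b i) * (b m - b (i + 1))) ∨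
        (∀ w ∈ D, (w.re - b i) * (w.re - b (i + 1)) + w.im ^ 2 < 0) ∧
          (∀ m, (b m - b i) * (b m - b (i + 1)) ≤ 0) := by
      intro i
      rcases pos_or_neg_of_ne_zero hDc.isPreconnected (hcont (b i) (b (i + 1)))
        (fun w hw h => hdisj w hw i ((hmem i w).2 h)) with h | h
      · left
        refine ⟨h, fun m => ?_⟩
        have := (endpoint_nonneg (a := b i) (b := b (i + 1)) (s := 1) (hne1 m)
          (fun w hw => by
            rw [one_mul]
            exact closure_minimal (fun v hv => (h v hv).le)
              (isClosed_le continuous_const (hcont _ _)) (hgeo m hw))).1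
        linarith
      · right
        refine ⟨h, fun m => ?_⟩
        have := (endpoint_nonneg (a := b i) (b := b (i + 1)) (s := -1) (hne1 m)
          (fun w hw => by
            have : (w.re - b i) * (w.re - b (i + 1)) + w.im ^ 2 ≤ 0 :=
              closure_minimal (fun v hv => (h v hv).le)
                (isClosed_le (hcont _ _) continuous_const) (hgeo m hw)
            linarith)).1
        linarith
    obtain ⟨M, hM⟩ := Finite.exists_max b
    -- Some side has a vertex strictly under its span, so `D` lies inside it: join the largest
    -- vertex to the smaller of its two neighbours; the other neighbour is in between.
    have hex : ∃ k, ∃ m, (b m - b k) * (b m - b (k + 1)) < 0 := by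
      have d1 : b (M - 1) < b M := lt_of_le_of_ne (hM _) fun h => h1n (by simpa using hbinj h)
      have d2 : b (M + 1) < b M := lt_of_le_of_ne (hM _) fun h => h1n (by simpa using hbinj h)
      have d3 : b (M - 1) ≠ b (M + 1) := by
        intro h
        have := hbinj h
        apply h2n
        linear_combination -this
      rcases lt_or_gt_of_ne d3 with h | h
      · refine ⟨M - 1, M + 1, ?_⟩
        rw [sub_add_cancel]
        nlinarith
      · refine ⟨M, M - 1, ?_⟩
        nlinarith
    obtain ⟨k, m, hkm⟩ := hex
    obtain ⟨hk1, hk2⟩ : (∀ w ∈ D, (w.re - b k) * (w.re - b (k + 1)) + w.im ^ 2 < 0) ∧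
          (∀ m, (b m - b k) * (b m - b (k + 1)) ≤ 0) := by
      rcases hside k with h | h
      · exact absurd (h.2 m) (not_le.2 hkm)
      · exact h
    -- The other `n - 1` sides lead from `k + 1` back to `k`, so one of them spans `z.re`.
    have hN : k + 1 + ((n - 1 : ℕ) : ZMod n) = k := by
      rw [Nat.cast_sub (by omega)]
      simp
    have hz' := hk1 z hz
    have hzi := pow_pos z.im_pos 2
    obtain ⟨j, hj, hjm⟩ := exists_mem_uIoc_of_crossing (fun j : ℕ => b (k + 1 + j)) (n - 1) z.re (by
      simp only [Nat.cast_zero, add_zero, hN]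
      rw [Set.mem_uIoc]
      have h3 : (z.re - b k) * (z.re - b (k + 1)) < 0 := by linarith
      rcases mul_neg_iff.1 h3 with h | h
      · right
        constructor <;> linarith
      · left
        constructor <;> linarith)
    have hi1 : k + 1 + (j : ZMod n) ≠ k := by
      have := zmod_add_natCast_ne k (j := j + 1) (by omega) (by omega)
      intro h; apply this; push_cast; linear_combination h
    refine ⟨k + 1 + j, ?_, z.im_pos, ?_⟩
    · simpa [add_assoc] using hjm
    · generalize k + 1 + (j : ZMod n) = i at hi1
      rcases hside i with h | h
      · exact h.1 z hz
      · exfalso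
        -- If `D` were inside side `i` as well, each of the sides `i` and `k` would span the
        -- endpoints of the other, so their endpoints would coincide. That forces `i = k`, or `2 =
        -- 0` in `ZMod n`.
        have f1 := h.2 k
        have f2 := h.2 (k + 1)
        have f3 := hk2 i
        have f4 := hk2 (i + 1)
        have g1 : b i ≠ b k := fun h => hi1 (hbinj h)
        have g2 : b (i + 1) ≠ b (k + 1) := fun h => hi1 (by simpa using hbinj h)
        have g3 : ¬ (b i = b (k + 1) ∧ b (i + 1) = b k) := by
          rintro ⟨h1, h2⟩
          have h1 := hbinj h1
          have h2 := hbinj h2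
          apply h2n
          linear_combination h2 - h1
        rw [mul_nonpos_iff] at f1 f2 f3 f4
        grind

/-! ### Finite hyperbolic area -/

open MeasureTheory in
-- An explicit antiderivative, bounded up to the endpoints, is the arcsine of the affine coordinate
-- sending `[p, q]` to `[-1, 1]`.
theorem integrableOn_inv_sqrt_mul {p q : ℝ} (hpq : p < q) :
    IntegrableOn (fun x => (Real.sqrt ((x - p) * (q - x)))⁻¹) (Set.Ioc p q) := by
  have hL : 0 < q - p := sub_pos.2 hpq
  refine intervalIntegral.integrableOn_deriv_of_nonneg
    (g := fun x => Real.arcsin ((2 * x - p - q) / (q - p))) ?_ ?_ ?_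
  · exact (Real.continuous_arcsin.comp (by fun_prop)).continuousOn
  · intro x hx
    have h1 : 0 < (x - p) * (q - x) := mul_pos (sub_pos.2 hx.1) (sub_pos.2 hx.2)
    have h2 : 1 - ((2 * x - p - q) / (q - p)) ^ 2 = (x - p) * (q - x) * (2 / (q - p)) ^ 2 := by
      field_simp
      ring
    have h3 : 0 < 1 - ((2 * x - p - q) / (q - p)) ^ 2 := by
      rw [h2]; positivity
    have hd : HasDerivAt (fun x => (2 * x - p - q) / (q - p)) (2 / (q - p)) x := by
      have := ((((hasDerivAt_id x).const_mul 2).sub_const p).sub_const q).div_const (q - p)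
      simpa using this
    have := (Real.hasDerivAt_arcsin (x := (2 * x - p - q) / (q - p))
      (by intro h; rw [h] at h3; norm_num at h3) (by intro h; rw [h] at h3; norm_num at h3)).comp x hd
    refine this.congr_deriv ?_
    rw [h2, Real.sqrt_mul h1.le, Real.sqrt_sq (by positivity)]
    have := Real.sqrt_pos.2 h1
    field_simp
  · intro x _
    positivity

open MeasureTheory in
theorem lintegral_Ioi_inv_sq {c : ℝ} (hc : 0 < c) :
    ∫⁻ y in Set.Ioi c, ENNReal.ofReal ((y ^ 2)⁻¹) = ENNReal.ofReal c⁻¹ := by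
  have h1 := integrableOn_Ioi_rpow_of_lt (a := -2) (by norm_num) hc
  have h2 := integral_Ioi_rpow_of_lt (a := -2) (by norm_num) hc
  have e : Set.EqOn (fun y : ℝ => y ^ (-2 : ℝ)) (fun y => (y ^ 2)⁻¹) (Set.Ioi c) := by
    intro y hy
    simp only
    rw [Real.rpow_neg (hc.trans hy).le]
    norm_cast
  rw [integrableOn_congr_fun e measurableSet_Ioi] at h1
  rw [setIntegral_congr_fun measurableSet_Ioi e] at h2
  rw [← ofReal_integral_eq_lintegral_ofReal h1 (ae_of_all _ fun y => by positivity), h2]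
  congr 1
  norm_num
  rw [Real.rpow_neg hc.le]
  simp

theorem stripAbove_comm (p q : ℝ) : stripAbove p q = stripAbove q p := by
  ext z
  simp only [stripAbove, Set.mem_ofPred_eq, Set.uIoc_comm p q, mul_comm (z.re - p)]

open MeasureTheory in
/-- The region between two vertical geodesics and above the geodesic joining their real endpoints
has finite hyperbolic area. -/
theorem integrableOn_stripAbove (p q : ℝ) :
    IntegrableOn (fun z : ℂ => (z.im ^ 2)⁻¹) (stripAbove p q) := by
  wlog hpq : p ≤ q generalizing p q
  · rw [stripAbove_comm]
    exact this q p (le_of_not_ge hpq)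
  rcases hpq.eq_or_lt with rfl | hpq
  · simp [stripAbove]
  refine ⟨by fun_prop, ?_⟩
  rw [hasFiniteIntegral_iff_ofReal (ae_of_all _ fun z => by positivity)]
  set T : Set (ℝ × ℝ) :=
    {w | w.1 ∈ Set.uIoc p q ∧ 0 < w.2 ∧ 0 < (w.1 - p) * (w.1 - q) + w.2 ^ 2} with hTdef
  have hT : MeasurableSet T := by
    change MeasurableSet ((Prod.fst ⁻¹' Set.uIoc p q) ∩
      ({w | 0 < w.2} ∩ {w | 0 < (w.1 - p) * (w.1 - q) + w.2 ^ 2}))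
    refine (measurable_fst measurableSet_uIoc).inter ((measurableSet_lt ?_ ?_).inter
      (measurableSet_lt ?_ ?_)) <;> fun_prop
  have hpre : stripAbove p q = Complex.measurableEquivRealProd ⁻¹' T := rfl
  have e1 := Complex.volume_preserving_equiv_real_prod.setLIntegral_comp_preimage_emb
    Complex.measurableEquivRealProd.measurableEmbedding
    (fun w : ℝ × ℝ => ENNReal.ofReal ((w.2 ^ 2)⁻¹)) T
  have e2 : ∫⁻ z in stripAbove p q, ENNReal.ofReal ((z.im ^ 2)⁻¹)
      = ∫⁻ w in T, ENNReal.ofReal ((w.2 ^ 2)⁻¹) := by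
    rw [hpre, ← e1]
    rfl
  rw [e2, ← lintegral_indicator hT, Measure.volume_eq_prod, lintegral_prod _ (by
    refine (Measurable.indicator ?_ hT).aemeasurable
    fun_prop)]
  calc _ ≤ ∫⁻ x, (Set.Ioc p q).indicator (fun x => ∫⁻ y in Set.Ioi (Real.sqrt ((x - p) * (q - x))),
        ENNReal.ofReal ((y ^ 2)⁻¹)) x := by
        refine lintegral_mono fun x => ?_
        by_cases hx : x ∈ Set.Ioc p q
        · rw [Set.indicator_of_mem hx, ← lintegral_indicator measurableSet_Ioi]
          refine lintegral_mono fun y => ?_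
          by_cases hy : (x, y) ∈ T
          · rw [Set.indicator_of_mem hy, Set.indicator_of_mem]
            rw [Set.mem_Ioi, Real.sqrt_lt' hy.2.1]
            have := hy.2.2
            simp only at this
            linarith
          · rw [Set.indicator_of_notMem hy]
            exact zero_le
        · rw [Set.indicator_of_notMem hx]
          refine le_of_eq ?_
          rw [lintegral_eq_zero_iff']
          · refine ae_of_all _ fun y => Set.indicator_of_notMem (fun h => hx ?_) _
            have := h.1
            rwa [Set.uIoc_of_le hpq.le] at this
          · refine Measurable.aemeasurable ?_
            exact ((Measurable.indicator (by fun_prop) hT).comp measurable_prodMk_left)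
    -- The endpoints are dropped because the inner integral starts at height `0` there and cannot be
    -- evaluated as a finite reciprocal.
    _ = ∫⁻ x in Set.Ioo p q, ∫⁻ y in Set.Ioi (Real.sqrt ((x - p) * (q - x))),
        ENNReal.ofReal ((y ^ 2)⁻¹) := by
        rw [lintegral_indicator measurableSet_Ioc, restrict_Ioo_eq_restrict_Ioc]
    _ = ∫⁻ x in Set.Ioo p q, ENNReal.ofReal ((Real.sqrt ((x - p) * (q - x)))⁻¹) := by
        refine setLIntegral_congr_fun measurableSet_Ioo fun x hx => ?_
        exact lintegral_Ioi_inv_sq (Real.sqrt_pos.2 (mul_pos (sub_pos.2 hx.1) (sub_pos.2 hx.2)))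
    _ < ⊤ := by
        have := (integrableOn_inv_sqrt_mul hpq).mono_set Set.Ioo_subset_Ioc_self
        have := this.2
        rwa [hasFiniteIntegral_iff_ofReal (ae_of_all _ fun z => by positivity)] at this

open MeasureTheory in
/-- A domain bounded by an ideal geodesic polygon has finite hyperbolic area. -/
theorem integrableOn_of_isIdealPolygon_frontier {D : Set ℍ} (hDo : IsOpen D) (hDc : IsConnected D)
    (hD : IsIdealPolygon (frontier D)) :
    IntegrableOn (fun z : ℂ => (z.im ^ 2)⁻¹) ((fun z : ℍ => (z : ℂ)) '' D) := by
  obtain ⟨s, hs⟩ := exists_stripAbove_cover hDo hDc hD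
  have h : IntegrableOn (fun z : ℂ => (z.im ^ 2)⁻¹) (⋃ p ∈ s, stripAbove p.1 p.2) :=
    (integrableOn_finset_iUnion).2 fun p _ => integrableOn_stripAbove _ _
  refine h.mono_set ?_
  rintro _ ⟨z, hz, rfl⟩
  obtain ⟨p, hp, hzp⟩ := hs z hz
  exact Set.mem_biUnion hp hzp

/-! ### Step functions of `u - v` and cutoffs with small gradient -/

/-- The square of the positive part, a `C¹` function. -/
noncomputable def posSq (t : ℝ) : ℝ := max t 0 ^ 2

theorem posSq_nonneg (t : ℝ) : 0 ≤ posSq t := sq_nonneg _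

theorem posSq_of_nonpos {t : ℝ} (h : t ≤ 0) : posSq t = 0 := by simp [posSq, h]

theorem posSq_pos {t : ℝ} (h : 0 < t) : 0 < posSq t := by
  rw [posSq, max_eq_left h.le]; positivity

theorem posSq_mono {s t : ℝ} (h : s ≤ t) : posSq s ≤ posSq t :=
  pow_le_pow_left₀ (le_max_right _ _) (max_le_max_right _ h) 2

theorem hasDerivAt_posSq (t : ℝ) : HasDerivAt posSq (2 * max t 0) t := by
  rcases lt_trichotomy t 0 with h | rfl | h
  · rw [max_eq_right h.le, mul_zero]
    refine (hasDerivAt_const t (0 : ℝ)).congr_of_eventuallyEq ?_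
    filter_upwards [gt_mem_nhds h] with s hs
    exact posSq_of_nonpos hs.le
  · rw [max_self, mul_zero, hasDerivAt_iff_isLittleO]
    simp only [sub_zero, smul_zero, posSq_of_nonpos le_rfl]
    refine Asymptotics.IsBigO.trans_isLittleO (g := fun s : ℝ => s ^ 2) ?_ ?_
    · refine Asymptotics.IsBigO.of_bound 1 (Filter.Eventually.of_forall fun s => ?_)
      rw [one_mul, Real.norm_of_nonneg (posSq_nonneg s), Real.norm_of_nonneg (sq_nonneg s), posSq]
      rcases le_total s 0 with h | h
      · rw [max_eq_right h]; nlinarith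
      · rw [max_eq_left h]
    · simpa using Asymptotics.isLittleO_pow_id (𝕜 := ℝ) (n := 2) (by norm_num)
  · rw [max_eq_left h.le]
    have : HasDerivAt (fun s : ℝ => s ^ 2) (2 * t) t := by simpa using hasDerivAt_pow 2 t
    refine this.congr_of_eventuallyEq ?_
    filter_upwards [lt_mem_nhds h] with s hs
    rw [posSq, max_eq_left hs.le]

theorem contDiff_posSq : ContDiff ℝ 1 posSq := by
  rw [contDiff_one_iff_deriv]
  refine ⟨fun t => (hasDerivAt_posSq t).differentiableAt, ?_⟩
  have : deriv posSq = fun t => 2 * max t 0 := funext fun t => (hasDerivAt_posSq t).deriv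
  rw [this]
  fun_prop

/-- A bounded `C¹` function vanishing on `(-∞, ε]` and strictly increasing on `[ε, ∞)`. -/
noncomputable def boundedStep (ε t : ℝ) : ℝ := posSq (t - ε) / (1 + posSq (t - ε))

/-- The derivative of `boundedStep`. -/
noncomputable def boundedStepDeriv (ε t : ℝ) : ℝ := 2 * max (t - ε) 0 / (1 + posSq (t - ε)) ^ 2

theorem boundedStep_of_le {ε t : ℝ} (h : t ≤ ε) : boundedStep ε t = 0 := by
  simp [boundedStep, posSq_of_nonpos (sub_nonpos.2 h)]

theorem abs_boundedStep_le (ε t : ℝ) : |boundedStep ε t| ≤ 1 := by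
  have := posSq_nonneg (t - ε)
  rw [boundedStep, abs_of_nonneg (by positivity), div_le_one (by positivity)]
  linarith

theorem boundedStepDeriv_nonneg (ε t : ℝ) : 0 ≤ boundedStepDeriv ε t := by
  have := le_max_right (t - ε) 0
  unfold boundedStepDeriv
  positivity

theorem boundedStepDeriv_of_le {ε t : ℝ} (h : t ≤ ε) : boundedStepDeriv ε t = 0 := by
  simp [boundedStepDeriv, h]

theorem boundedStepDeriv_pos {ε t : ℝ} (h : ε < t) : 0 < boundedStepDeriv ε t := by
  have h1 := posSq_nonneg (t - ε)
  rw [boundedStepDeriv, max_eq_left (sub_pos.2 h).le]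
  have := sub_pos.2 h
  positivity

theorem continuous_boundedStepDeriv (ε : ℝ) : Continuous (boundedStepDeriv ε) := by
  have := contDiff_posSq.continuous
  unfold boundedStepDeriv
  refine Continuous.div (by fun_prop) (by fun_prop) fun t => ?_
  have h1 := posSq_nonneg (t - ε)
  positivity

theorem contDiff_boundedStep (ε : ℝ) : ContDiff ℝ 1 (boundedStep ε) := by
  have h : ContDiff ℝ 1 fun t => posSq (t - ε) :=
    contDiff_posSq.comp (contDiff_id.sub contDiff_const)
  refine h.div (contDiff_const.add h) fun t => ?_
  have h1 := posSq_nonneg (t - ε)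
  positivity

theorem hasDerivAt_boundedStep (ε t : ℝ) :
    HasDerivAt (boundedStep ε) (boundedStepDeriv ε t) t := by
  have h : HasDerivAt (fun t => posSq (t - ε)) (2 * max (t - ε) 0) t := by
    refine ((hasDerivAt_posSq (t - ε)).comp t ((hasDerivAt_id t).sub_const ε)).congr_deriv ?_
    simp
  have h1 := posSq_nonneg (t - ε)
  refine (h.div (h.const_add 1) (by positivity)).congr_deriv ?_
  unfold boundedStepDeriv
  congr 1
  ring

/-- The logarithm of `2 cosh d(z, i)`, a proper function on the half-plane with bounded
hyperbolic gradient. -/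
noncomputable def logHeight (z : ℂ) : ℝ := Real.log ((z.re ^ 2 + z.im ^ 2 + 1) / z.im)

theorem logHeight_nonneg {z : ℂ} (hz : 0 < z.im) : 0 ≤ logHeight z := by
  refine Real.log_nonneg ?_
  rw [le_div_iff₀ hz]
  nlinarith [sq_nonneg z.re, sq_nonneg (z.im - 1)]

theorem contDiffOn_logHeight : ContDiffOn ℝ 1 logHeight {z | 0 < z.im} := by
  have hre : ContDiff ℝ 1 Complex.re := Complex.reCLM.contDiff
  have him : ContDiff ℝ 1 Complex.im := Complex.imCLM.contDiff
  have hne : ∀ z : ℂ, z.re ^ 2 + z.im ^ 2 + 1 ≠ 0 := fun z => by positivity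
  refine ContDiffOn.log ?_ ?_
  · refine ContDiffOn.div (ContDiff.contDiffOn (by fun_prop)) him.contDiffOn fun z hz => ?_
    exact (show 0 < z.im from hz).ne'
  · intro z hz
    exact div_ne_zero (hne z) (show 0 < z.im from hz).ne'

theorem hasFDerivAt_logHeight {z : ℂ} (hz : 0 < z.im) :
    HasFDerivAt logHeight
      ((2 * z.re / (z.re ^ 2 + z.im ^ 2 + 1)) • Complex.reCLM +
        (2 * z.im / (z.re ^ 2 + z.im ^ 2 + 1) - 1 / z.im) • Complex.imCLM) z := by
  have hre : HasFDerivAt Complex.re Complex.reCLM z := Complex.reCLM.hasFDerivAt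
  have him : HasFDerivAt Complex.im Complex.imCLM z := Complex.imCLM.hasFDerivAt
  have hS : (0 : ℝ) < z.re ^ 2 + z.im ^ 2 + 1 := by positivity
  have h1 := ((hre.pow 2).add (him.pow 2)).add_const 1
  have h2 := (h1.log hS.ne').sub (him.log hz.ne')
  have h3 := h2.congr_of_eventuallyEq (f₁ := logHeight) (by
    filter_upwards [(isOpen_lt continuous_const Complex.continuous_im).mem_nhds hz] with w hw
    have hw' : (0 : ℝ) < w.re ^ 2 + w.im ^ 2 + 1 := by positivity
    exact Real.log_div hw'.ne' (show 0 < w.im from hw).ne')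
  refine h3.congr_fderiv ?_
  ext
  simp
  field_simp
  ring

/-- Hyperbolic gradients have length `im z` times the Euclidean one, so `1 / im z` is a uniform
hyperbolic bound. It amounts to `2 |x| y ≤ x² + y² + 1`. -/
theorem abs_partialX_logHeight_le {z : ℂ} (hz : 0 < z.im) : |partialX logHeight z| ≤ 1 / z.im := by
  have hS : (0 : ℝ) < z.re ^ 2 + z.im ^ 2 + 1 := by positivity
  rw [partialX, (hasFDerivAt_logHeight hz).fderiv]
  simp only [add_apply, smul_apply, Complex.reCLM_apply,
    Complex.imCLM_apply, Complex.one_re, Complex.one_im, smul_eq_mul, mul_one, mul_zero, add_zero]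
  rw [abs_le, ← neg_div, div_le_div_iff₀ hz hS, div_le_div_iff₀ hS hz]
  constructor <;> nlinarith [sq_nonneg (z.re - z.im), sq_nonneg (z.re + z.im)]

theorem abs_partialY_logHeight_le {z : ℂ} (hz : 0 < z.im) : |partialY logHeight z| ≤ 1 / z.im := by
  have hS : (0 : ℝ) < z.re ^ 2 + z.im ^ 2 + 1 := by positivity
  rw [partialY, (hasFDerivAt_logHeight hz).fderiv]
  simp only [add_apply, smul_apply, Complex.reCLM_apply,
    Complex.imCLM_apply, Complex.I_re, Complex.I_im, smul_eq_mul, mul_one, mul_zero, zero_add]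
  have h1 : 0 ≤ 2 * z.im / (z.re ^ 2 + z.im ^ 2 + 1) := by positivity
  have h2 : 2 * z.im / (z.re ^ 2 + z.im ^ 2 + 1) ≤ 2 * (1 / z.im) := by
    rw [mul_one_div, div_le_div_iff₀ hS hz]
    nlinarith [sq_nonneg z.re]
  rw [abs_le]
  constructor <;> linarith

/-- Compactly supported cutoff functions on the half-plane, with hyperbolic gradient `O(1/m)`. -/
noncomputable def cutoff (m : ℝ) (z : ℂ) : ℝ := posSq (1 - logHeight z / m)

theorem cutoff_mono {m m' : ℝ} (hm : 0 < m) (h : m ≤ m') {z : ℂ} (hz : 0 < z.im) :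
    cutoff m z ≤ cutoff m' z := by
  refine posSq_mono ?_
  have := div_le_div_of_nonneg_left (logHeight_nonneg hz) hm h
  linarith

theorem cutoff_pos {m : ℝ} {z : ℂ} (hm : 0 < m) (h : logHeight z < m) : 0 < cutoff m z := by
  refine posSq_pos ?_
  rw [sub_pos, div_lt_one hm]
  exact h

theorem cutoff_of_le {m : ℝ} {z : ℂ} (hm : 0 < m) (h : m ≤ logHeight z) : cutoff m z = 0 := by
  refine posSq_of_nonpos ?_
  rw [sub_nonpos, one_le_div hm]
  exact h

theorem contDiffOn_cutoff (m : ℝ) : ContDiffOn ℝ 1 (cutoff m) {z | 0 < z.im} :=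
  contDiff_posSq.comp_contDiffOn (contDiffOn_const.sub (contDiffOn_logHeight.div_const m))

theorem fderiv_cutoff (m : ℝ) {z : ℂ} (hz : 0 < z.im) (e : ℂ) :
    fderiv ℝ (cutoff m) z e =
      -(2 * max (1 - logHeight z / m) 0 / m * fderiv ℝ logHeight z e) := by
  have h1 := (hasFDerivAt_logHeight hz).differentiableAt.hasFDerivAt
  have h2 := (h1.mul_const m⁻¹).const_sub 1
  have h3 := (hasDerivAt_posSq (1 - logHeight z * m⁻¹)).comp_hasFDerivAt z h2
  have h4 : cutoff m = posSq ∘ fun w => 1 - logHeight w * m⁻¹ := by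
    ext w; simp [cutoff, div_eq_mul_inv]
  rw [h4, h3.fderiv]
  simp [div_eq_mul_inv]
  ring

theorem abs_fderiv_cutoff_le {m : ℝ} (hm : 0 < m) {z : ℂ} (hz : 0 < z.im) {e : ℂ}
    (he : |fderiv ℝ logHeight z e| ≤ 1 / z.im) : |fderiv ℝ (cutoff m) z e| ≤ 2 / m * (1 / z.im) := by
  have h0 : 0 ≤ max (1 - logHeight z / m) 0 := le_max_right _ _
  have h1 : max (1 - logHeight z / m) 0 ≤ 1 := by
    have := div_nonneg (logHeight_nonneg hz) hm.le
    exact max_le (by linarith) zero_le_one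
  rw [fderiv_cutoff m hz, abs_neg, abs_mul]
  refine mul_le_mul ?_ he (abs_nonneg _) (by positivity)
  rw [abs_of_nonneg (by positivity)]
  exact div_le_div_of_nonneg_right (by linarith) hm.le

/-! ### Extension by zero and integration by parts -/

theorem ContDiffOn.partialX {Ω : Set ℂ} (hΩ : IsOpen Ω) {f : ℂ → ℝ} {n m : WithTop ℕ∞}
    (hf : ContDiffOn ℝ n f Ω) (h : m + 1 ≤ n) : ContDiffOn ℝ m (partialX f) Ω :=
  (hf.fderiv_of_isOpen hΩ h).clm_apply contDiffOn_const

theorem ContDiffOn.partialY {Ω : Set ℂ} (hΩ : IsOpen Ω) {f : ℂ → ℝ} {n m : WithTop ℕ∞}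
    (hf : ContDiffOn ℝ n f Ω) (h : m + 1 ≤ n) : ContDiffOn ℝ m (partialY f) Ω :=
  (hf.fderiv_of_isOpen hΩ h).clm_apply contDiffOn_const

section
variable {Ω K : Set ℂ}

theorem eventuallyEq_indicator_zero (hK : IsCompact K) {φ : ℂ → ℝ}
    (h0 : ∀ z ∈ Ω, z ∉ K → φ z = 0) {z : ℂ} (hz : z ∉ K) : Ω.indicator φ =ᶠ[nhds z] 0 := by
  filter_upwards [hK.isClosed.isOpen_compl.mem_nhds hz] with w hw
  by_cases hwΩ : w ∈ Ω
  · rw [Set.indicator_of_mem hwΩ, h0 w hwΩ hw]; rfl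
  · rw [Set.indicator_of_notMem hwΩ]; rfl

theorem eventuallyEq_indicator (hΩ : IsOpen Ω) {φ : ℂ → ℝ} {z : ℂ} (hz : z ∈ Ω) :
    Ω.indicator φ =ᶠ[nhds z] φ := by
  filter_upwards [hΩ.mem_nhds hz] with w hw
  exact Set.indicator_of_mem hw _

theorem hasCompactSupport_indicator (hK : IsCompact K) {φ : ℂ → ℝ}
    (h0 : ∀ z ∈ Ω, z ∉ K → φ z = 0) : HasCompactSupport (Ω.indicator φ) := by
  refine HasCompactSupport.intro hK fun z hz => ?_
  by_cases hzΩ : z ∈ Ω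
  · rw [Set.indicator_of_mem hzΩ, h0 z hzΩ hz]
  · rw [Set.indicator_of_notMem hzΩ]

/-- Off the compact set `K` the extension by zero is locally zero, and near `K` it is `φ`; the
boundary of `Ω` plays no role. -/
theorem contDiff_indicator (hΩ : IsOpen Ω) (hK : IsCompact K) (hKΩ : K ⊆ Ω) {φ : ℂ → ℝ}
    {n : WithTop ℕ∞} (hφ : ContDiffOn ℝ n φ Ω) (h0 : ∀ z ∈ Ω, z ∉ K → φ z = 0) :
    ContDiff ℝ n (Ω.indicator φ) := by
  rw [contDiff_iff_contDiffAt]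
  intro z
  by_cases hz : z ∈ K
  · exact (hφ.contDiffAt (hΩ.mem_nhds (hKΩ hz))).congr_of_eventuallyEq
      (eventuallyEq_indicator hΩ (hKΩ hz))
  · exact contDiffAt_const.congr_of_eventuallyEq (eventuallyEq_indicator_zero hK h0 hz)

theorem continuous_indicator_of_compact (hΩ : IsOpen Ω) (hK : IsCompact K) (hKΩ : K ⊆ Ω)
    {φ : ℂ → ℝ} (hφ : ContinuousOn φ Ω) (h0 : ∀ z ∈ Ω, z ∉ K → φ z = 0) :
    Continuous (Ω.indicator φ) :=
  (contDiff_indicator hΩ hK hKΩ (contDiffOn_zero.2 hφ) h0).continuous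

open MeasureTheory

theorem integral_fderiv_apply_eq_zero {φ : ℂ → ℝ} (hφ : ContDiff ℝ 1 φ)
    (hc : HasCompactSupport φ) (e : ℂ) : ∫ z, fderiv ℝ φ z e = 0 := by
  have h1 : Continuous fun z => fderiv ℝ φ z e :=
    (hφ.continuous_fderiv one_ne_zero).clm_apply continuous_const
  have h2 : HasCompactSupport fun z => fderiv ℝ φ z e := hc.fderiv_apply ℝ e
  have := integral_mul_fderiv_eq_neg_fderiv_mul_of_integrable (μ := volume) (𝕜 := ℝ)
    (f := fun _ : ℂ => (1 : ℝ)) (g := φ) (v := e) (by simp)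
    (by simpa using h1.integrable_of_hasCompactSupport h2)
    (by simpa using hφ.continuous.integrable_of_hasCompactSupport hc)
    (by fun_prop) (fun z _ => hφ.differentiable one_ne_zero z)
  simpa using this

/-- The weak form of the equation `P_x + Q_y = 0`. -/
theorem integral_weak_divergence (hΩ : IsOpen Ω) (hK : IsCompact K) (hKΩ : K ⊆ Ω) {P Q ρ : ℂ → ℝ}
    (hP : ContDiffOn ℝ 1 P Ω) (hQ : ContDiffOn ℝ 1 Q Ω) (hρ : ContDiffOn ℝ 1 ρ Ω)
    (hdiv : ∀ z ∈ Ω, partialX P z + partialY Q z = 0) (h0 : ∀ z ∈ Ω, z ∉ K → ρ z = 0) :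
    IntegrableOn (fun z => partialX ρ z * P z + partialY ρ z * Q z) Ω ∧
      ∫ z in Ω, (partialX ρ z * P z + partialY ρ z * Q z) = 0 := by
  have c1 : ContDiff ℝ 1 (Ω.indicator fun z => ρ z * P z) :=
    contDiff_indicator hΩ hK hKΩ (hρ.mul hP) fun z hz hzK => by simp [h0 z hz hzK]
  have c2 : ContDiff ℝ 1 (Ω.indicator fun z => ρ z * Q z) :=
    contDiff_indicator hΩ hK hKΩ (hρ.mul hQ) fun z hz hzK => by simp [h0 z hz hzK]
  have s1 : HasCompactSupport (Ω.indicator fun z => ρ z * P z) :=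
    hasCompactSupport_indicator hK fun z hz hzK => by simp [h0 z hz hzK]
  have s2 : HasCompactSupport (Ω.indicator fun z => ρ z * Q z) :=
    hasCompactSupport_indicator hK fun z hz hzK => by simp [h0 z hz hzK]
  have i1 : Integrable fun z => fderiv ℝ (Ω.indicator fun z => ρ z * P z) z 1 :=
    ((c1.continuous_fderiv one_ne_zero).clm_apply continuous_const).integrable_of_hasCompactSupport
      (s1.fderiv_apply ℝ 1)
  have i2 : Integrable fun z => fderiv ℝ (Ω.indicator fun z => ρ z * Q z) z Complex.I :=
    ((c2.continuous_fderiv one_ne_zero).clm_apply continuous_const).integrable_of_hasCompactSupport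
      (s2.fderiv_apply ℝ Complex.I)
  -- The integrand is the full divergence of `(ρ P, ρ Q)`, since `ρ (P_x + Q_y) = 0`.
  have e : (Ω.indicator fun z => partialX ρ z * P z + partialY ρ z * Q z) =
      fun z => fderiv ℝ (Ω.indicator fun z => ρ z * P z) z 1 +
        fderiv ℝ (Ω.indicator fun z => ρ z * Q z) z Complex.I := by
    ext z
    by_cases hz : z ∈ Ω
    · have dP := (hP.contDiffAt (hΩ.mem_nhds hz)).differentiableAt one_ne_zero
      have dQ := (hQ.contDiffAt (hΩ.mem_nhds hz)).differentiableAt one_ne_zero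
      have dρ := (hρ.contDiffAt (hΩ.mem_nhds hz)).differentiableAt one_ne_zero
      rw [Set.indicator_of_mem hz, (eventuallyEq_indicator hΩ hz).fderiv_eq,
        (eventuallyEq_indicator hΩ hz).fderiv_eq, fderiv_fun_mul dρ dP, fderiv_fun_mul dρ dQ]
      have := hdiv z hz
      simp only [partialX, partialY] at this ⊢
      simp only [add_apply, smul_apply, smul_eq_mul]
      linear_combination (-ρ z) * this
    · have hzK : z ∉ K := fun h => hz (hKΩ h)
      rw [Set.indicator_of_notMem hz,
        (eventuallyEq_indicator_zero hK (fun z hz hzK => by simp [h0 z hz hzK]) hzK).fderiv_eq,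
        (eventuallyEq_indicator_zero hK (fun z hz hzK => by simp [h0 z hz hzK]) hzK).fderiv_eq]
      simp
  constructor
  · rw [← integrable_indicator_iff hΩ.measurableSet, e]
    exact i1.add i2
  · rw [← integral_indicator hΩ.measurableSet, e, integral_add i1 i2,
      integral_fderiv_apply_eq_zero c1 s1, integral_fderiv_apply_eq_zero c2 s2, add_zero]

end

/-! ### The flux of the minimal surface equation: bounds and monotonicity -/

/-- The `x`-component of the Euclidean flux `∇f / W` of the minimal surface equation. -/
noncomputable def fluxX (f : ℂ → ℝ) (z : ℂ) : ℝ := (fluxField f z).re / z.im ^ 2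

/-- The `y`-component of the Euclidean flux `∇f / W` of the minimal surface equation. -/
noncomputable def fluxY (f : ℂ → ℝ) (z : ℂ) : ℝ := (fluxField f z).im / z.im ^ 2

/-- The area factor `W = √(1 + |∇f|²)` in terms of the Euclidean gradient. -/
noncomputable def areaFactor (y p q : ℝ) : ℝ := Real.sqrt (1 + y ^ 2 * (p ^ 2 + q ^ 2))

theorem one_add_hypNorm_sq (f : ℂ → ℝ) {z : ℂ} (hz : 0 < z.im) :
    1 + hypNorm z (hypGrad f z) ^ 2 = 1 + z.im ^ 2 * (partialX f z ^ 2 + partialY f z ^ 2) := by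
  rw [hypNorm, div_pow, Complex.sq_norm, Complex.normSq_apply, hypGrad]
  field_simp

/-- The factor `y²` of the hyperbolic gradient cancels the area density `1 / y²`, so the metric
survives only inside `W`. -/
theorem fluxX_eq (f : ℂ → ℝ) {z : ℂ} (hz : 0 < z.im) :
    fluxX f z = partialX f z / areaFactor z.im (partialX f z) (partialY f z) := by
  rw [fluxX, fluxField, Complex.div_ofReal_re, one_add_hypNorm_sq f hz, areaFactor, hypGrad]
  field_simp

theorem fluxY_eq (f : ℂ → ℝ) {z : ℂ} (hz : 0 < z.im) :
    fluxY f z = partialY f z / areaFactor z.im (partialX f z) (partialY f z) := by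
  rw [fluxY, fluxField, Complex.div_ofReal_im, one_add_hypNorm_sq f hz, areaFactor, hypGrad]
  field_simp

theorem areaFactor_pos (y p q : ℝ) : 0 < areaFactor y p q := Real.sqrt_pos.2 (by positivity)

theorem areaFactor_sq (y p q : ℝ) : areaFactor y p q ^ 2 = 1 + y ^ 2 * (p ^ 2 + q ^ 2) :=
  Real.sq_sqrt (by positivity)

theorem contDiffOn_flux {Ω : Set ℂ} (hΩ : IsOpen Ω) (hpos : ∀ z ∈ Ω, 0 < z.im) {f : ℂ → ℝ}
    (hf : ContDiffOn ℝ 2 f Ω) : ContDiffOn ℝ 1 (fluxX f) Ω ∧ ContDiffOn ℝ 1 (fluxY f) Ω := by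
  have hx : ContDiffOn ℝ 1 (partialX f) Ω := hf.partialX hΩ (by norm_num)
  have hy : ContDiffOn ℝ 1 (partialY f) Ω := hf.partialY hΩ (by norm_num)
  have him : ContDiffOn ℝ 1 Complex.im Ω := Complex.imCLM.contDiff.contDiffOn
  have hW : ContDiffOn ℝ 1 (fun z => areaFactor z.im (partialX f z) (partialY f z)) Ω := by
    refine ContDiffOn.sqrt (by fun_prop) fun z _ => ?_
    positivity
  constructor
  · exact (hx.div hW fun z _ => (areaFactor_pos _ _ _).ne').congr fun z hz => fluxX_eq f (hpos z hz)
  · exact (hy.div hW fun z _ => (areaFactor_pos _ _ _).ne').congr fun z hz => fluxY_eq f (hpos z hz)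

/-- `W ≥ y |p|` and `W ≥ y |q|`: the flux is bounded without any control of the gradient. -/
theorem abs_div_areaFactor_le {y : ℝ} (hy : 0 < y) (p q : ℝ) :
    |p / areaFactor y p q| ≤ 1 / y ∧ |q / areaFactor y p q| ≤ 1 / y := by
  have h := areaFactor_pos y p q
  have hs := areaFactor_sq y p q
  constructor
  · rw [abs_div, abs_of_pos h, div_le_div_iff₀ h hy, one_mul]
    refine abs_le_of_sq_le_sq' ?_ h.le |>.2
    rw [mul_pow, sq_abs, hs]
    nlinarith [sq_nonneg (y * q)]
  · rw [abs_div, abs_of_pos h, div_le_div_iff₀ h hy, one_mul]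
    refine abs_le_of_sq_le_sq' ?_ h.le |>.2
    rw [mul_pow, sq_abs, hs]
    nlinarith [sq_nonneg (y * p)]

/-- The monotonicity of the flux `p ↦ p / √(1 + y² |p|²)`, written as an identity. -/
theorem flux_monotone_identity {y : ℝ} (p q p' q' : ℝ) :
    y ^ 2 * ((p - p') * (p / areaFactor y p q - p' / areaFactor y p' q') +
      (q - q') * (q / areaFactor y p q - q' / areaFactor y p' q')) =
    (areaFactor y p q + areaFactor y p' q') / (areaFactor y p q * areaFactor y p' q') *
      (areaFactor y p q * areaFactor y p' q' - (1 + y ^ 2 * (p * p' + q * q'))) := by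
  have h := areaFactor_pos y p q
  have hs := areaFactor_sq y p q
  have h' := areaFactor_pos y p' q'
  have hs' := areaFactor_sq y p' q'
  generalize areaFactor y p q = W at *
  generalize areaFactor y p' q' = W' at *
  field_simp
  linear_combination (-W') * hs - W * hs'

/-- Cauchy–Schwarz for `(1, y p, y q)` and `(1, y p', y q')`; the defect of the squares is a sum of
three squares by Lagrange's identity. -/
theorem le_areaFactor_mul {y : ℝ} (p q p' q' : ℝ) :
    1 + y ^ 2 * (p * p' + q * q') ≤ areaFactor y p q * areaFactor y p' q' := by
  rw [areaFactor, areaFactor, ← Real.sqrt_mul (by positivity)]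
  refine Real.le_sqrt_of_sq_le ?_
  nlinarith [sq_nonneg (y * (p - p')), sq_nonneg (y * (q - q')),
    sq_nonneg (y ^ 2 * (p * q' - q * p'))]

theorem flux_monotone {y : ℝ} (hy : 0 < y) (p q p' q' : ℝ) :
    0 ≤ (p - p') * (p / areaFactor y p q - p' / areaFactor y p' q') +
      (q - q') * (q / areaFactor y p q - q' / areaFactor y p' q') := by
  have h := flux_monotone_identity (y := y) p q p' q'
  have h1 := areaFactor_pos y p q
  have h2 := areaFactor_pos y p' q'
  have h3 := sub_nonneg.2 (le_areaFactor_mul (y := y) p q p' q')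
  refine nonneg_of_mul_nonneg_right (h ▸ ?_) (pow_pos hy 2)
  positivity

/-- The equality case of that Cauchy–Schwarz inequality: parallel vectors with the same first entry
`1` are equal. -/
theorem eq_of_flux_eq_zero {y : ℝ} (hy : 0 < y) {p q p' q' : ℝ}
    (h0 : (p - p') * (p / areaFactor y p q - p' / areaFactor y p' q') +
      (q - q') * (q / areaFactor y p q - q' / areaFactor y p' q') = 0) : p = p' ∧ q = q' := by
  have h := flux_monotone_identity (y := y) p q p' q'
  have h1 := areaFactor_pos y p q
  have h2 := areaFactor_pos y p' q'
  rw [h0, mul_zero, eq_comm, mul_eq_zero, or_iff_right (by positivity), sub_eq_zero] at h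
  have h3 : areaFactor y p q ^ 2 * areaFactor y p' q' ^ 2 = (1 + y ^ 2 * (p * p' + q * q')) ^ 2 := by
    rw [← h]; ring
  rw [areaFactor_sq, areaFactor_sq] at h3
  have h4 : (y * (p - p')) ^ 2 + (y * (q - q')) ^ 2 + (y ^ 2 * (p * q' - q * p')) ^ 2 = 0 := by
    linear_combination h3
  have h5 : (y * (p - p')) ^ 2 = 0 := by
    nlinarith [sq_nonneg (y * (p - p')), sq_nonneg (y * (q - q')),
      sq_nonneg (y ^ 2 * (p * q' - q * p'))]
  have h6 : (y * (q - q')) ^ 2 = 0 := by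
    nlinarith [sq_nonneg (y * (p - p')), sq_nonneg (y * (q - q')),
      sq_nonneg (y ^ 2 * (p * q' - q * p'))]
  constructor
  · have := (mul_eq_zero.1 (pow_eq_zero_iff two_ne_zero |>.1 h5)).resolve_left hy.ne'
    linarith
  · have := (mul_eq_zero.1 (pow_eq_zero_iff two_ne_zero |>.1 h6)).resolve_left hy.ne'
    linarith

/-! ### The integral estimate: gradients agree where `u > v` -/

open MeasureTheory in
/-- Over a region of finite hyperbolic area, two solutions of the minimal surface equation have the
same gradient wherever `f - g` is positive, provided `f - g` is nonpositive at the boundary in the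
sense that its superlevel sets at positive levels are compact inside each `{logHeight ≤ m}`. -/
theorem partial_eq_of_pos {Ω : Set ℂ} (hΩ : IsOpen Ω) (hpos : ∀ z ∈ Ω, 0 < z.im)
    (harea : IntegrableOn (fun z : ℂ => (z.im ^ 2)⁻¹) Ω) {f g : ℂ → ℝ}
    (hf : ContDiffOn ℝ 2 f Ω) (hg : ContDiffOn ℝ 2 g Ω)
    (hfeq : ∀ z ∈ Ω, partialX (fluxX f) z + partialY (fluxY f) z = 0)
    (hgeq : ∀ z ∈ Ω, partialX (fluxX g) z + partialY (fluxY g) z = 0)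
    (hK : ∀ ε > 0, ∀ m : ℝ, IsCompact {z | z ∈ Ω ∧ ε ≤ f z - g z ∧ logHeight z ≤ m}) :
    ∀ z ∈ Ω, 0 < f z - g z → partialX f z = partialX g z ∧ partialY f z = partialY g z := by
  intro z₀ hz₀ hw₀
  -- `ε > 0` gives the test function compact support; `ε < w z₀` keeps the derivative of the step
  -- positive at `z₀`.
  obtain ⟨ε, hε, hεw⟩ := exists_between hw₀
  set w : ℂ → ℝ := fun z => f z - g z with hw
  set P : ℂ → ℝ := fun z => fluxX f z - fluxX g z with hP
  set Q : ℂ → ℝ := fun z => fluxY f z - fluxY g z with hQ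
  have hsub : Ω ⊆ {z : ℂ | 0 < z.im} := hpos
  have hw2 : ContDiffOn ℝ 2 w Ω := hf.sub hg
  have hP1 : ContDiffOn ℝ 1 P Ω :=
    (contDiffOn_flux hΩ hpos hf).1.sub (contDiffOn_flux hΩ hpos hg).1
  have hQ1 : ContDiffOn ℝ 1 Q Ω :=
    (contDiffOn_flux hΩ hpos hf).2.sub (contDiffOn_flux hΩ hpos hg).2
  have hdiff : ∀ {h : ℂ → ℝ} {n : WithTop ℕ∞}, ContDiffOn ℝ n h Ω → n ≠ 0 → ∀ z ∈ Ω,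
      DifferentiableAt ℝ h z := fun hh hn z hz =>
    (hh.contDiffAt (hΩ.mem_nhds hz)).differentiableAt hn
  have hwX : ∀ z ∈ Ω, partialX w z = partialX f z - partialX g z := by
    intro z hz
    simp only [partialX, hw]
    rw [fderiv_fun_sub (hdiff hf two_ne_zero z hz) (hdiff hg two_ne_zero z hz)]
    rfl
  have hwY : ∀ z ∈ Ω, partialY w z = partialY f z - partialY g z := by
    intro z hz
    simp only [partialY, hw]
    rw [fderiv_fun_sub (hdiff hf two_ne_zero z hz) (hdiff hg two_ne_zero z hz)]
    rfl
  have hdiv : ∀ z ∈ Ω, partialX P z + partialY Q z = 0 := by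
    intro z hz
    have h1 := hfeq z hz
    have h2 := hgeq z hz
    have cf := contDiffOn_flux hΩ hpos hf
    have cg := contDiffOn_flux hΩ hpos hg
    simp only [partialX, partialY, hP, hQ] at h1 h2 ⊢
    rw [fderiv_fun_sub (hdiff cf.1 one_ne_zero z hz) (hdiff cg.1 one_ne_zero z hz),
      fderiv_fun_sub (hdiff cf.2 one_ne_zero z hz) (hdiff cg.2 one_ne_zero z hz)]
    simp only [sub_apply]
    linear_combination h1 - h2
  have hPQ : ∀ z ∈ Ω, |P z| ≤ 2 * (1 / z.im) ∧ |Q z| ≤ 2 * (1 / z.im) := by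
    intro z hz
    have h1 := abs_div_areaFactor_le (hpos z hz) (partialX f z) (partialY f z)
    have h2 := abs_div_areaFactor_le (hpos z hz) (partialX g z) (partialY g z)
    simp only [hP, hQ, fluxX_eq _ (hpos z hz), fluxY_eq _ (hpos z hz)]
    constructor
    · refine (abs_sub _ _).trans ?_
      linarith [h1.1, h2.1]
    · refine (abs_sub _ _).trans ?_
      linarith [h1.2, h2.2]
  have hmono : ∀ z ∈ Ω, 0 ≤ partialX w z * P z + partialY w z * Q z := by
    intro z hz
    simp only [hwX z hz, hwY z hz, hP, hQ, fluxX_eq _ (hpos z hz), fluxY_eq _ (hpos z hz)]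
    exact flux_monotone (hpos z hz) _ _ _ _
  -- The test function is `cutoff m * boundedStep ε ∘ w`; `E` comes from differentiating the step
  -- and `R` from differentiating the cutoff.
  set E : ℝ → ℂ → ℝ := fun m z =>
    cutoff m z * (boundedStepDeriv ε (w z) * (partialX w z * P z + partialY w z * Q z)) with hE
  set R : ℝ → ℂ → ℝ := fun m z =>
    boundedStep ε (w z) * (partialX (cutoff m) z * P z + partialY (cutoff m) z * Q z) with hR
  set A : ℝ := ∫ z in Ω, (z.im ^ 2)⁻¹ with hA
  have hEnn : ∀ m, ∀ z ∈ Ω, 0 ≤ E m z := fun m z hz =>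
    mul_nonneg (posSq_nonneg _) (mul_nonneg (boundedStepDeriv_nonneg _ _) (hmono z hz))
  have hKΩ : ∀ m, {z | z ∈ Ω ∧ ε ≤ f z - g z ∧ logHeight z ≤ m} ⊆ Ω := fun m z hz => hz.1
  have hEoff : ∀ m > 0, ∀ z ∈ Ω, z ∉ {z | z ∈ Ω ∧ ε ≤ f z - g z ∧ logHeight z ≤ m} →
      E m z = 0 := by
    intro m hm z hz hzK
    by_cases h : ε ≤ f z - g z
    · have : m ≤ logHeight z := by
        by_contra! h2
        exact hzK ⟨hz, h, h2.le⟩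
      simp only [hE, cutoff_of_le hm this, zero_mul]
    · simp only [hE, boundedStepDeriv_of_le (show w z ≤ ε from (not_le.1 h).le), zero_mul, mul_zero]
  have hEcont : ∀ m, ContinuousOn (E m) Ω := by
    intro m
    have c1 := ((contDiffOn_cutoff m).mono hsub).continuousOn
    have c2 := (continuous_boundedStepDeriv ε).comp_continuousOn hw2.continuousOn
    have c3 := (hw2.partialX hΩ (m := 1) (by norm_num)).continuousOn
    have c4 := (hw2.partialY hΩ (m := 1) (by norm_num)).continuousOn
    exact c1.mul (c2.mul ((c3.mul hP1.continuousOn).add (c4.mul hQ1.continuousOn)))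
  have hEind : ∀ m > 0, Continuous (Ω.indicator (E m)) ∧ HasCompactSupport (Ω.indicator (E m)) :=
    fun m hm => ⟨continuous_indicator_of_compact hΩ (hK ε hε m) (hKΩ m) (hEcont m) (hEoff m hm),
      hasCompactSupport_indicator (hK ε hε m) (hEoff m hm)⟩
  have hEint : ∀ m > 0, IntegrableOn (E m) Ω := by
    intro m hm
    rw [← integrable_indicator_iff hΩ.measurableSet]
    exact (hEind m hm).1.integrable_of_hasCompactSupport (hEind m hm).2
  -- `∫ E = -∫ R`. In `R` the step is at most `1`, and each of the two products is at most `(2 / (m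
  -- y)) * (2 / y)`, whence `8 / (m y²)`.
  have hbound : ∀ m > 0, ∫ z in Ω, E m z ≤ 8 / m * A := by
    intro m hm
    have hcut : ContDiffOn ℝ 1 (cutoff m) Ω := (contDiffOn_cutoff m).mono hsub
    have hstep : ContDiffOn ℝ 1 (fun z => boundedStep ε (w z)) Ω :=
      (contDiff_boundedStep ε).comp_contDiffOn (hw2.of_le (by norm_num))
    obtain ⟨hi, h0⟩ := integral_weak_divergence hΩ (hK ε hε m) (hKΩ m) hP1 hQ1 (hcut.mul hstep)
      hdiv (by
        intro z hz hzK
        by_cases h : ε ≤ f z - g z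
        · have : m ≤ logHeight z := by
            by_contra! h2
            exact hzK ⟨hz, h, h2.le⟩
          simp only [cutoff_of_le hm this, zero_mul]
        · simp only [hw, boundedStep_of_le (not_le.1 h).le, mul_zero])
    have e : ∀ z ∈ Ω, partialX (fun z => cutoff m z * boundedStep ε (w z)) z * P z +
        partialY (fun z => cutoff m z * boundedStep ε (w z)) z * Q z = E m z + R m z := by
      intro z hz
      have d1 := hdiff hcut one_ne_zero z hz
      have d2 := hdiff hstep one_ne_zero z hz
      have d3 := (hdiff hw2 two_ne_zero z hz).hasFDerivAt
      have d4 : fderiv ℝ (fun z => boundedStep ε (w z)) z =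
          boundedStepDeriv ε (w z) • fderiv ℝ w z :=
        ((hasDerivAt_boundedStep ε (w z)).comp_hasFDerivAt z d3).fderiv
      simp only [partialX, partialY, hE, hR]
      rw [fderiv_fun_mul d1 d2, d4]
      simp only [add_apply, smul_apply, smul_eq_mul]
      ring
    have hRint : IntegrableOn (R m) Ω := by
      refine (hi.sub (hEint m hm)).congr_fun (fun z hz => ?_) hΩ.measurableSet
      have := e z hz
      simp only [Pi.sub_apply]
      linear_combination this
    rw [setIntegral_congr_fun hΩ.measurableSet e, integral_add (hEint m hm) hRint] at h0
    have h1 : ∫ z in Ω, E m z = ∫ z in Ω, -R m z := by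
      rw [integral_neg]; linarith
    rw [h1, hA, ← integral_const_mul]
    refine setIntegral_mono_on hRint.neg (harea.const_mul _) hΩ.measurableSet fun z hz => ?_
    have hz' := hpos z hz
    have b1 := abs_fderiv_cutoff_le hm hz' (abs_partialX_logHeight_le hz')
    have b2 := abs_fderiv_cutoff_le hm hz' (abs_partialY_logHeight_le hz')
    have b3 := hPQ z hz
    have b4 : |partialX (cutoff m) z * P z + partialY (cutoff m) z * Q z| ≤
        8 / m * (z.im ^ 2)⁻¹ := by
      refine (abs_add_le _ _).trans ?_
      rw [abs_mul, abs_mul]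
      have m1 := mul_le_mul b1 b3.1 (abs_nonneg _) (by positivity)
      have m2 := mul_le_mul b2 b3.2 (abs_nonneg _) (by positivity)
      refine (add_le_add m1 m2).trans (le_of_eq ?_)
      field_simp
      norm_num
    refine (neg_le_abs _).trans ?_
    rw [abs_mul]
    have := mul_le_mul (abs_boundedStep_le ε (w z)) b4 (abs_nonneg _) zero_le_one
    rwa [one_mul] at this
  obtain ⟨m, hm⟩ := exists_gt (logHeight z₀)
  have hm0 : 0 < m := (logHeight_nonneg (hpos z₀ hz₀)).trans_lt hm
  -- `E` increases with `m`, so the integral at the fixed `m` is bounded by `8 A / m'` for all large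
  -- `m'`.
  have hle : ∫ z in Ω, E m z ≤ 0 := by
    have hlim : Filter.Tendsto (fun m : ℝ => 8 / m * A) Filter.atTop (nhds 0) := by
      simpa using (Filter.tendsto_id.const_div_atTop (8 : ℝ)).mul_const A
    refine ge_of_tendsto hlim ?_
    filter_upwards [Filter.eventually_ge_atTop m] with m' hm'
    refine le_trans ?_ (hbound m' (hm0.trans_le hm'))
    refine setIntegral_mono_on (hEint m hm0) (hEint m' (hm0.trans_le hm')) hΩ.measurableSet
      fun z hz => ?_
    exact mul_le_mul_of_nonneg_right (cutoff_mono hm0 hm' (hpos z hz))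
      (mul_nonneg (boundedStepDeriv_nonneg _ _) (hmono z hz))
  have hEz : E m z₀ = 0 := by
    by_contra hne
    have := (hEind m hm0).1.integral_pos_of_hasCompactSupport_nonneg_nonzero (μ := volume)
      (x := z₀) (hEind m hm0).2 (fun z => Set.indicator_nonneg (hEnn m) z)
      (by rwa [Set.indicator_of_mem hz₀])
    rw [integral_indicator hΩ.measurableSet] at this
    linarith
  have hzero : partialX w z₀ * P z₀ + partialY w z₀ * Q z₀ = 0 := by
    have h1 := cutoff_pos hm0 hm
    have h2 := boundedStepDeriv_pos hεw
    rcases mul_eq_zero.1 hEz with h | h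
    · exact absurd h h1.ne'
    · exact (mul_eq_zero.1 h).resolve_left h2.ne'
  simp only [hwX z₀ hz₀, hwY z₀ hz₀, hP, hQ, fluxX_eq _ (hpos z₀ hz₀),
    fluxY_eq _ (hpos z₀ hz₀)] at hzero
  exact eq_of_flux_eq_zero (hpos z₀ hz₀) hzero

/-! ### From equal gradients to the contradiction -/

/-- The condition reads `x² + y² + 1 ≤ e^m y`, a closed and bounded set in `ℂ` which cannot reach
the real axis. -/
theorem isCompact_logHeight_le (m : ℝ) : IsCompact {z : ℍ | logHeight z ≤ m} := by
  have hlog : ∀ z : ℂ, 0 < z.im →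
      (logHeight z ≤ m ↔ z.re ^ 2 + z.im ^ 2 + 1 ≤ Real.exp m * z.im) := by
    intro z hz
    rw [logHeight, Real.log_le_iff_le_exp (by positivity), div_le_iff₀ hz]
  have hc : IsCompact {z : ℂ | z.re ^ 2 + z.im ^ 2 + 1 ≤ Real.exp m * z.im} := by
    refine Metric.isCompact_of_isClosed_isBounded
      (isClosed_le (by fun_prop) (by fun_prop)) ?_
    refine (Metric.isBounded_closedBall (x := (0 : ℂ)) (r := Real.exp m)).subset fun z hz => ?_
    have hz : z.re ^ 2 + z.im ^ 2 + 1 ≤ Real.exp m * z.im := hz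
    have he := Real.exp_pos m
    rw [mem_closedBall_zero_iff]
    refine abs_le_of_sq_le_sq' ?_ he.le |>.2
    rw [Complex.sq_norm, Complex.normSq_apply]
    nlinarith [sq_nonneg (z.im - Real.exp m)]
  have := isEmbedding_coe.isCompact_preimage_iff (K := {z : ℂ | z.re ^ 2 + z.im ^ 2 + 1 ≤ Real.exp m * z.im})
    (fun z hz => ⟨⟨z, by
      have hz : z.re ^ 2 + z.im ^ 2 + 1 ≤ Real.exp m * z.im := hz
      by_contra! h
      nlinarith [Real.exp_pos m, sq_nonneg z.re, sq_nonneg z.im]⟩, rfl⟩) |>.2 hc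
  convert this using 1
  ext z
  exact hlog z z.im_pos

theorem IsIdealPolygon.nonempty {Γ : Set ℍ} (h : IsIdealPolygon Γ) : Γ.Nonempty := by
  obtain ⟨n, hn, a, ha, -, rfl⟩ := h
  have : (0 : ZMod n) ≠ 1 := by
    have : Fact (1 < n) := ⟨by omega⟩
    exact zero_ne_one
  have hne : a 0 ≠ a (0 + 1) := fun h => this (by simpa using ha h)
  suffices h : (idealGeodesic (a 0) (a (0 + 1))).Nonempty from
    h.mono (Set.subset_iUnion (fun i => idealGeodesic (a i) (a (i + 1))) 0)
  generalize a 0 = p at hne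
  generalize a (0 + 1) = q at hne
  induction p using OnePoint.rec with
  | infty =>
    induction q using OnePoint.rec with
    | infty => exact absurd rfl hne
    | coe q => exact ⟨⟨⟨q, 1⟩, one_pos⟩, rfl⟩
  | coe p =>
    induction q using OnePoint.rec with
    | infty => exact ⟨⟨⟨p, 1⟩, one_pos⟩, rfl⟩
    | coe q =>
      have hpq : p - q ≠ 0 := sub_ne_zero.2 fun h => hne (by rw [h])
      have := sq_pos_of_ne_zero hpq
      obtain ⟨z, -, hz, -⟩ := exists_mem_idealGeodesic_re (p := p) (q := q) (x := (p + q) / 2)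
        (by nlinarith)
      exact ⟨z, hz⟩

/-- The minimal surface equation in terms of the Euclidean flux. -/
theorem IsMinimalSolution.flux {U : Set ℍ} {u : ℍ → ℝ} (h : IsMinimalSolution U u) :
    ∀ z ∈ (fun z : ℍ => (z : ℂ)) '' U,
      partialX (fluxX (inCoord u)) z + partialY (fluxY (inCoord u)) z = 0 := by
  rintro _ ⟨z, hz, rfl⟩
  have := h.2 z hz
  rw [hypDiv, mul_eq_zero] at this
  exact this.resolve_left (pow_pos z.im_pos 2).ne'

/-- The derivative is known to vanish only where `w > 0`. The level set of the positive value `w z₀`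
is still open, as `w` stays positive on a small disc; its complement in `U` is open by continuity.
-/
theorem eq_of_pos_of_partial_eq {U : Set ℍ} (hUo : IsOpen U) (hUc : IsPreconnected U)
    {w : ℍ → ℝ} (hd : ∀ z ∈ U, 0 < w z → HasFDerivAt (inCoord w) (0 : ℂ →L[ℝ] ℝ) z)
    (hw : ContinuousOn w U) {z₀ : ℍ} (hz₀ : z₀ ∈ U) (hpos : 0 < w z₀) : ∀ z ∈ U, w z = w z₀ := by
  have hop : IsOpen {z | z ∈ U ∧ w z = w z₀} := by
    rw [isOpen_iff_mem_nhds]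
    rintro z ⟨hz, hzw⟩
    have h1 : {x | x ∈ U ∧ 0 < w x} ∈ nhds z := by
      have := (hw.continuousAt (hUo.mem_nhds hz)).eventually (lt_mem_nhds (hzw ▸ hpos))
      filter_upwards [hUo.mem_nhds hz, this] with x h1 h2 using ⟨h1, h2⟩
    rw [isOpenEmbedding_coe.nhds_eq_comap] at h1 ⊢
    obtain ⟨t, ht, hts⟩ := h1
    have ht' := Filter.inter_mem ht (isOpenEmbedding_coe.isOpen_range.mem_nhds ⟨z, rfl⟩)
    obtain ⟨r, hr, hball⟩ := Metric.mem_nhds_iff.1 ht'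
    refine ⟨Metric.ball z r, Metric.ball_mem_nhds _ hr, fun x hx => ?_⟩
    have hxt : x ∈ (fun z : ℍ => (z : ℂ)) ⁻¹' t := (hball hx).1
    refine ⟨(hts hxt).1, ?_⟩
    have hder : ∀ y ∈ Metric.ball (z : ℂ) r, HasFDerivAt (inCoord w) (0 : ℂ →L[ℝ] ℝ) y := by
      intro y hy
      obtain ⟨hyt, ⟨y, rfl⟩⟩ := hball hy
      have := hts hyt
      exact hd y this.1 this.2
    have := (convex_ball (z : ℂ) r).is_const_of_fderivWithin_eq_zero (𝕜 := ℝ) (f := inCoord w)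
      (fun y hy => (hder y hy).differentiableAt.differentiableWithinAt)
      (fun y hy => by
        rw [fderivWithin_of_isOpen Metric.isOpen_ball hy, (hder y hy).fderiv])
      hx (Metric.mem_ball_self hr)
    simp only [inCoord, ofComplex_apply] at this
    rw [this, hzw]
  have hop2 : IsOpen {z | z ∈ U ∧ w z ≠ w z₀} :=
    hw.isOpen_inter_preimage hUo isOpen_ne
  by_contra! hne
  obtain ⟨z, hz, hzw⟩ := hne
  obtain ⟨x, -, hx1, hx2⟩ := hUc _ _ hop hop2 (fun x hx => by
    by_cases h : w x = w z₀
    · exact Or.inl ⟨hx, h⟩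
    · exact Or.inr ⟨hx, h⟩) ⟨z₀, hz₀, hz₀, rfl⟩ ⟨z, hz, hz, hzw⟩
  exact hx2.2 hx1.2

theorem theorem2 (D U : Set ℍ) (u v : ℍ → ℝ)
    (hDo : IsOpen D) (hDc : IsConnected D) (hD : IsIdealPolygon (frontier D))
    (hUo : IsOpen U) (hUc : IsConnected U) (hUD : U ⊆ D)
    (hu : ContinuousOn u (closure U)) (hv : ContinuousOn v (closure U))
    (hus : IsMinimalSolution U u) (hvs : IsMinimalSolution U v)
    (hle : ∀ z ∈ frontier U, u z ≤ v z) :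
    ∀ z ∈ U, u z ≤ v z := by
  by_contra! hcon
  obtain ⟨z₀, hz₀, hlt⟩ := hcon
  have hwc : ContinuousOn (fun z => u z - v z) (closure U) := hu.sub hv
  set Ω : Set ℂ := (fun z : ℍ => (z : ℂ)) '' U with hΩdef
  have hΩ : IsOpen Ω := isOpenEmbedding_coe.isOpenMap U hUo
  have hpos : ∀ z ∈ Ω, 0 < z.im := by
    rintro _ ⟨z, -, rfl⟩
    exact z.im_pos
  have harea := (integrableOn_of_isIdealPolygon_frontier hDo hDc hD).mono_set (Set.image_mono hUD)
  have hpart := partial_eq_of_pos hΩ hpos harea hus.1 hvs.1 hus.flux hvs.flux (by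
    intro ε hε m
    have hcl : IsClosed (closure U ∩ (fun z => u z - v z) ⁻¹' Set.Ici ε) :=
      hwc.preimage_isClosed_of_isClosed isClosed_closure isClosed_Ici
    have hc := ((isCompact_logHeight_le m).inter_right hcl).image continuous_coe
    convert hc using 1
    ext z
    constructor
    · rintro ⟨⟨z, hz, rfl⟩, h1, h2⟩
      simp only [inCoord, ofComplex_apply] at h1
      exact ⟨z, ⟨h2, subset_closure hz, h1⟩, rfl⟩
    · rintro ⟨z, ⟨h2, hz, h1⟩, rfl⟩
      have h1 : ε ≤ u z - v z := h1
      refine ⟨⟨z, ?_, rfl⟩, by simpa only [inCoord, ofComplex_apply] using h1, h2⟩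
      -- A point of the closure outside `U` is a boundary point, where `u - v ≤ 0 < ε`.
      by_contra hzU
      have := hle z (by rw [hUo.frontier_eq]; exact ⟨hz, hzU⟩)
      linarith)
  have hconst := eq_of_pos_of_partial_eq hUo hUc.isPreconnected (w := fun z => u z - v z) (by
    intro z hz hzw
    have hzΩ : (z : ℂ) ∈ Ω := ⟨z, hz, rfl⟩
    have du := (hus.1.contDiffAt (hΩ.mem_nhds hzΩ)).differentiableAt two_ne_zero
    have dv := (hvs.1.contDiffAt (hΩ.mem_nhds hzΩ)).differentiableAt two_ne_zero
    obtain ⟨h1, h2⟩ := hpart z hzΩ (by simpa only [inCoord, ofComplex_apply] using hzw)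
    refine (du.hasFDerivAt.sub dv.hasFDerivAt).congr_fderiv ?_
    rw [sub_eq_zero]
    refine ContinuousLinearMap.coe_injective (Complex.basisOneI.ext fun i => ?_)
    fin_cases i
    · simpa [partialX] using h1
    · simpa [partialY] using h2) (hwc.mono subset_closure) hz₀ (sub_pos.2 hlt)
  -- Without boundary, `U` would be all of `ℍ`, hence so would `D`, whose frontier is a non-empty
  -- polygon.
  obtain hempty | ⟨z, hz⟩ := (frontier U).eq_empty_or_nonempty
  · have hclopen : IsClopen U := isClopen_iff_frontier_eq_empty.2 hempty
    have hUuniv : U = Set.univ := hclopen.eq_univ ⟨z₀, hz₀⟩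
    have hDuniv : D = Set.univ := Set.univ_subset_iff.1 (hUuniv ▸ hUD)
    rw [hDuniv, frontier_univ] at hD
    exact hD.nonempty.ne_empty rfl
  · have hzc : z ∈ closure U := frontier_subset_closure hz
    have h1 : Set.EqOn (fun z => u z - v z) (fun _ => u z₀ - v z₀) (closure U) :=
      Set.EqOn.of_subset_closure (s := U) hconst hwc continuousOn_const subset_closure le_rfl
    have h2 := h1 hzc
    have h3 := hle z hz
    simp only at h2
    linarith
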